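/- Let \(G\) be a countable discrete abelian group, \(M\subseteq G\) a subgroup of finite index \(L\), and \(\ell_0,\dots,\ell_{L-1}\in G\) representatives of the cosets of \(M\), one for each coset. Let \(K\) be a positive integer, let \(h_1,\dots,h_K\in\ell^1(G)\) be complex-valued, put \(f_k(n)=\overline{h_k(-n)}\), and for \(m\in M\) let \((T_mf)(n)=f(n-m)\), \(n\in G\). Let \(\widehat M\) be the group of characters \(\gamma:M\to\mathbb T=\{z\in\mathbb C:|z|=1\}\), and for \(\gamma\in\widehat M\) let \(\mathbf H(\gamma)\) be the \(K\times L\) matrix with entries \[ H_{k,\ell_j}(\gamma)=\sum_{m\in M}h_k(m-\ell_j)\,\overline{\gamma(m)},\qquad 1\le k\le K,\ 0\le j\le L-1 . \] Assume that \(L=K\). Then the family \(\{T_mf_k\}_{1\le k\le K,\;m\in M}\) is a Riesz basis for \(\ell^2(G)\) (that is, the image of an orthonormal basis of \(\ell^2(G)\) under a bounded bijective operator on \(\ell^2(G)\)) if and only if \(\det\mathbf H(\gamma)\ne0\) for all \(\gamma\in\widehat M\). In this case the optimal Riesz bounds of the family, i.e. the largest \(A>0\) and the smallest \(B>0\) such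 that \[ A\sum_{k,m}|c_{k,m}|^2\le\Big\|\sum_{k,m}c_{k,m}T_mf_k\Big\|_2^2\le B\sum_{k,m}|c_{k,m}|^2 \] for all finitely supported complex families \((c_{k,m})\), are \[ A=\min_{\gamma\in\widehat M}\lambda_{\min}(\gamma),\qquad B=\max_{\gamma\in\widehat M}\lambda_{\max}(\gamma), \] where \(\lambda_{\min}(\gamma)\) and \(\lambda_{\max}(\gamma)\) are the smallest and the largest eigenvalue of \(\mathbf H(\gamma)^*\mathbf H(\gamma)\); this minimum and this maximum are attained. -/

import Mathlib

open scoped ENNReal ComplexConjugate Matrix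

noncomputable section

namespace FilterBank

/-- The space `ℓ^p(G)` of complex functions on a discrete set `G`. -/
abbrev ell (p : ℝ≥0∞) (G : Type*) := lp (fun _ : G => ℂ) p

section Sequences

variable {G : Type*} [AddCommGroup G]

theorem memlp_one_involution (f : ell 1 G) :
    Memℓp (fun n : G => conj (f (-n))) 1 := by
  have hf : Summable fun n : G => ‖f n‖ := by
    simpa using (lp.memℓp f).summable (by norm_num)
  refine memℓp_gen ?_
  simpa [Function.comp_def] using (Equiv.neg G).summable_iff.mpr hf

theorem memlp_two_translate (m : G) (x : ell 2 G) :
    Memℓp (fun n : G => x (n - m)) 2 := by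
  have hx : Summable fun n : G => ‖x n‖ ^ (2 : ℝ≥0∞).toReal :=
    (lp.memℓp x).summable (by norm_num)
  exact memℓp_gen ((Equiv.subRight m).summable_iff.mpr hx)

/-- The involution `f̃(n) = conj (f(-n))` on `ℓ¹(G)`. -/
def involution (f : ell 1 G) : ell 1 G :=
  ⟨fun n => conj (f (-n)), memlp_one_involution f⟩

/-- The inclusion `ℓ¹(G) ⊆ ℓ²(G)`. -/
def toEllTwo (f : ell 1 G) : ell 2 G :=
  ⟨fun n => f n, (lp.memℓp f).of_exponent_ge (by norm_num)⟩

/-- The translation `(T_m x)(n) = x(n - m)` on `ℓ²(G)`. -/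
def translate (m : G) (x : ell 2 G) : ell 2 G :=
  ⟨fun n => x (n - m), memlp_two_translate m x⟩

variable (M : AddSubgroup G) {κ ι : Type*}

/-- The family `(T_m f_k)`, indexed by the pairs `(k, m)` with `m ∈ M`, where `f_k` is the
involution of the analysis filter `h_k ∈ ℓ¹(G)`. -/
def translates (h : κ → ell 1 G) (p : κ × M) : ell 2 G :=
  translate (p.2 : G) (toEllTwo (involution (h p.1)))

/-- The `M`-Fourier transform `ĉ(γ) = ∑_{m ∈ M} c(m) conj ⟨m, γ⟩` at the character `γ` of the
discrete group `M`. -/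
def fourier (c : M → ℂ) (γ : AddChar M Circle) : ℂ :=
  ∑' m : M, c m * conj ((γ m : Circle) : ℂ)

/-- The polyphase analysis matrix: its entry `(k, i)` at `γ` is the `M`-Fourier transform of the
polyphase component `m ↦ h_k(m - ℓ_i)`. -/
def polyphase (h : κ → ell 1 G) (l : ι → G) (γ : AddChar M Circle) : Matrix κ ι ℂ :=
  Matrix.of fun k i => fourier M (fun m => h k ((m : G) - l i)) γ

end Sequences

section Eigenvalues

variable {κ ι : Type*} [Fintype κ] [Fintype ι] [DecidableEq ι]

/-- The smallest eigenvalue of `Hᴴ * H` (an infimum over the finite list of eigenvalues). -/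
def lambdaMin (H : Matrix κ ι ℂ) : ℝ :=
  ⨅ i, (Matrix.isHermitian_conjTranspose_mul_self H).eigenvalues i

/-- The largest eigenvalue of `Hᴴ * H` (a supremum over the finite list of eigenvalues). -/
def lambdaMax (H : Matrix κ ι ℂ) : ℝ :=
  ⨆ i, (Matrix.isHermitian_conjTranspose_mul_self H).eigenvalues i

end Eigenvalues

section Riesz

variable {E : Type*} [NormedAddCommGroup E] [InnerProductSpace ℂ E] {ι : Type*}

/-- A Riesz basis of a Hilbert space: the image of an orthonormal (Hilbert) basis under a bounded
bijective operator. -/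
def IsRieszBasis (v : ι → E) : Prop :=
  ∃ (e : HilbertBasis ι ℂ E) (U : E →L[ℂ] E), Function.Bijective U ∧ ∀ i, v i = U (e i)

/-- `a > 0` is a lower Riesz bound: `a ∑ |c_i|² ≤ ‖∑ c_i v_i‖²` for all finite sequences `c`. -/
def IsLowerRieszBound (v : ι → E) (a : ℝ) : Prop :=
  0 < a ∧ ∀ c : ι →₀ ℂ, a * (c.sum fun _ z => ‖z‖ ^ 2) ≤ ‖c.sum fun i z => z • v i‖ ^ 2

/-- `b > 0` is an upper Riesz bound: `‖∑ c_i v_i‖² ≤ b ∑ |c_i|²` for all finite sequences `c`. -/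
def IsUpperRieszBound (v : ι → E) (b : ℝ) : Prop :=
  0 < b ∧ ∀ c : ι →₀ ℂ, ‖c.sum fun i z => z • v i‖ ^ 2 ≤ b * (c.sum fun _ z => ‖z‖ ^ 2)

/-- `A` is the largest lower Riesz bound and `B` is the smallest upper Riesz bound. -/
def AreOptimalRieszBounds (v : ι → E) (A B : ℝ) : Prop :=
  IsGreatest {a | IsLowerRieszBound v a} A ∧ IsLeast {b | IsUpperRieszBound v b} B

end Riesz

end FilterBank

end

/-! Fourier transform along each of the `L` cosets of `M` identifies `ℓ²(G)` with the `ℂ^L`-valued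
`L²` functions on the compact dual of `M`. There `T_m f_k` becomes `conj γ(m)` times the conjugate
of row `k` of `H(γ)`, so synthesis from finitely supported coefficients is pointwise multiplication
by `H(γ)ᴴ`. Plancherel (`norm_sq_synthesis`, `integral_coeffFourier`) therefore turns a Riesz bound
into a comparison of `∫ |H(γ)ᴴ ĉ(γ)|²` with `∫ |ĉ(γ)|²`.

Pointwise eigenvalue bounds integrate to Riesz bounds. Conversely, testing with a trigonometric
polynomial times a fixed vector localizes the integral inequality at every `γ`
(`nonneg_of_integral_norm_sq_fourier_mul`). So the optimal constants are the extreme eigenvalues of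
`H Hᴴ`, which for square `H` are those of `Hᴴ H`. They are attained because `h_k ∈ ℓ¹` makes `H`
continuous on a compact space, and the least one is positive exactly when `det H` never vanishes.

For completeness (`dense_span_translates`), the equation `Hᴴ w = û`, with `û` the transform of a
unit vector, has a continuous solution by Cramer's rule, and Stone–Weierstrass approximates `w` by
transforms of finite coefficient families. A family with both bounds and dense span is a Riesz basis
(`isRieszBasis_of_bounds`). -/

noncomputable section

namespace FilterBank

open MeasureTheory Filter Topology

/-! ### The compact dual of a discrete abelian group and its Haar measure -/

section DualGroup

variable {A : Type*} [AddCommGroup A]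

/-- The topology of pointwise convergence on the characters of a discrete group. -/
instance addCharTopology : TopologicalSpace (AddChar A Circle) :=
  TopologicalSpace.induced (fun γ a => γ a) inferInstance

theorem isInducing_addChar_coe :
    IsInducing (fun (γ : AddChar A Circle) (a : A) => γ a) := ⟨rfl⟩

theorem isEmbedding_addChar_coe :
    IsEmbedding (fun (γ : AddChar A Circle) (a : A) => γ a) :=
  ⟨isInducing_addChar_coe, DFunLike.coe_injective⟩

theorem continuous_addChar_apply (a : A) : Continuous fun γ : AddChar A Circle => γ a :=
  (continuous_apply a).comp isInducing_addChar_coe.continuous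

theorem continuous_addChar_coe (a : A) :
    Continuous fun γ : AddChar A Circle => ((γ a : Circle) : ℂ) :=
  continuous_subtype_val.comp (continuous_addChar_apply a)

theorem range_addChar_coe :
    Set.range (fun (γ : AddChar A Circle) (a : A) => γ a) =
      {f | f 0 = 1} ∩ ⋂ a, ⋂ b, {f | f (a + b) = f a * f b} := by
  ext f
  simp only [Set.mem_range, Set.mem_inter_iff, Set.mem_ofPred_eq, Set.mem_iInter]
  constructor
  · rintro ⟨γ, rfl⟩
    exact ⟨γ.map_zero_eq_one, fun a b => γ.map_add_eq_mul a b⟩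
  · rintro ⟨h0, h1⟩
    exact ⟨⟨f, h0, h1⟩, rfl⟩

/-- Being a homomorphism is a family of closed conditions on the values, so the dual inherits
compactness from the product of circles. -/
theorem isClosedEmbedding_addChar_coe :
    IsClosedEmbedding (fun (γ : AddChar A Circle) (a : A) => γ a) := by
  refine ⟨isEmbedding_addChar_coe, ?_⟩
  rw [range_addChar_coe]
  refine (isClosed_eq (continuous_apply _) continuous_const).inter ?_
  refine isClosed_iInter fun a => isClosed_iInter fun b => ?_
  exact isClosed_eq (continuous_apply _) ((continuous_apply a).mul (continuous_apply b))

instance : CompactSpace (AddChar A Circle) := isClosedEmbedding_addChar_coe.compactSpace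

instance : T2Space (AddChar A Circle) := isEmbedding_addChar_coe.t2Space

instance : IsTopologicalGroup (AddChar A Circle) where
  continuous_mul := isInducing_addChar_coe.continuous_iff.mpr <| continuous_pi fun a =>
    ((continuous_addChar_apply a).comp continuous_fst).mul
      ((continuous_addChar_apply a).comp continuous_snd)
  continuous_inv := by
    refine isInducing_addChar_coe.continuous_iff.mpr <| continuous_pi fun a => ?_
    simpa [Function.comp_def] using continuous_addChar_apply (-a)

instance : MeasurableSpace (AddChar A Circle) := borel _

instance : BorelSpace (AddChar A Circle) := ⟨rfl⟩

/-- A character of a discrete abelian group can be chosen nontrivial at any nonzero point. -/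
theorem exists_addChar_ne_one {a : A} (ha : a ≠ 0) : ∃ γ : AddChar A Circle, γ a ≠ 1 := by
  obtain ⟨c, hc⟩ := CharacterModule.exists_character_apply_ne_zero_of_ne_zero ha
  -- The separating character `c` takes values in `ℚ/ℤ`; the injection `ℚ/ℤ → ℝ/ℤ` followed by
  -- `AddCircle.toCircle` makes it unitary.
  let φ : AddCircle (1 : ℚ) →+ AddCircle (1 : ℝ) :=
    QuotientAddGroup.map _ _ (Rat.castHom ℝ : ℚ →+* ℝ).toAddMonoidHom (by
      rw [AddSubgroup.zmultiples_le]
      simp [AddSubgroup.mem_zmultiples])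
  have hφ : ∀ x, φ x = 0 → x = 0 := by
    intro x
    induction x using QuotientAddGroup.induction_on with
    | H q =>
      intro hq
      have hq' : ((q : ℝ) : AddCircle (1 : ℝ)) = 0 := hq
      rw [AddCircle.coe_eq_zero_iff] at hq'
      obtain ⟨n, hn⟩ := hq'
      have : ((q : ℚ) : AddCircle (1 : ℚ)) = 0 := by
        rw [AddCircle.coe_eq_zero_iff]
        refine ⟨n, ?_⟩
        simp only [zsmul_eq_mul, mul_one] at hn ⊢
        exact_mod_cast hn
      exact this
  let cc : A →+ AddCircle (1 : ℚ) := c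
  refine ⟨⟨fun b => AddCircle.toCircle (φ (cc b)), by simp, fun x y => by
    simp [AddCircle.toCircle_add]⟩, fun h => hc (hφ _ ?_)⟩
  have h' : AddCircle.toCircle (φ (cc a)) = AddCircle.toCircle (0 : AddCircle (1 : ℝ)) := by
    rw [AddCircle.toCircle_zero]; exact h
  exact AddCircle.injective_toCircle one_ne_zero h'

/-- The normalized Haar measure of the compact dual group of a discrete abelian group. -/
def dualHaar (A : Type*) [AddCommGroup A] : Measure (AddChar A Circle) :=
  Measure.haarMeasure ⊤

instance : (dualHaar A).IsHaarMeasure := by unfold dualHaar; infer_instance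

instance : IsProbabilityMeasure (dualHaar A) :=
  ⟨by simpa [dualHaar] using Measure.haarMeasure_self (G := AddChar A Circle) (K₀ := ⊤)⟩

/-- Translation by `γ₀` multiplies the integral by `γ₀ a`; choosing `γ₀ a ≠ 1` forces it to vanish.
-/
theorem integral_addChar (a : A) [Decidable (a = 0)] :
    ∫ γ : AddChar A Circle, ((γ a : Circle) : ℂ) ∂(dualHaar A) = if a = 0 then 1 else 0 := by
  split_ifs with h
  · simp [h]
  · obtain ⟨γ₀, hγ⟩ := exists_addChar_ne_one h
    have := integral_mul_left_eq_self (μ := dualHaar A)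
      (fun γ : AddChar A Circle => ((γ a : Circle) : ℂ)) γ₀
    simp only [AddChar.mul_apply, Circle.coe_mul] at this
    rw [integral_const_mul] at this
    have h1 : ((γ₀ a : Circle) : ℂ) - 1 ≠ 0 := by
      rw [sub_ne_zero]
      exact fun h => hγ (by ext; simpa using h)
    refine (mul_eq_zero.mp ?_).resolve_left h1
    rw [sub_mul, this, one_mul, sub_self]

theorem integrable_of_continuous {E : Type*} [NormedAddCommGroup E] 
    [SecondCountableTopology E] {f : AddChar A Circle → E}
    (hf : Continuous f) : Integrable f (dualHaar A) :=
  hf.integrable_of_hasCompactSupport (HasCompactSupport.of_compactSpace f)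

end DualGroup

/-! ### Fourier series on the dual of `M`: density and Plancherel -/

section Fourier

variable {G : Type*} [AddCommGroup G] {M : AddSubgroup G}

theorem norm_mul_conj_char (z : ℂ) (γ : AddChar M Circle) (m : M) :
    ‖z * conj ((γ m : Circle) : ℂ)‖ = ‖z‖ := by
  rw [norm_mul, RCLike.norm_conj, Circle.norm_coe, mul_one]

theorem summable_fourier {c : M → ℂ} (hc : Summable fun m => ‖c m‖) (γ : AddChar M Circle) :
    Summable fun m : M => c m * conj ((γ m : Circle) : ℂ) := by
  refine Summable.of_norm ?_
  simpa only [norm_mul_conj_char] using hc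

theorem continuous_fourier {c : M → ℂ} (hc : Summable fun m => ‖c m‖) :
    Continuous (fourier M c) := by
  refine continuous_tsum (fun m => ?_) hc fun m γ => (norm_mul_conj_char _ _ _).le
  exact continuous_const.mul (Complex.continuous_conj.comp (continuous_addChar_coe m))

theorem fourier_add {c d : M → ℂ} (hc : Summable fun m => ‖c m‖)
    (hd : Summable fun m => ‖d m‖) (γ : AddChar M Circle) :
    fourier M (fun m => c m + d m) γ = fourier M c γ + fourier M d γ := by
  simp only [fourier, add_mul]
  exact (summable_fourier hc γ).tsum_add (summable_fourier hd γ)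

theorem fourier_sub {c d : M → ℂ} (hc : Summable fun m => ‖c m‖)
    (hd : Summable fun m => ‖d m‖) (γ : AddChar M Circle) :
    fourier M (fun m => c m - d m) γ = fourier M c γ - fourier M d γ := by
  simp only [fourier, sub_mul]
  exact (summable_fourier hc γ).tsum_sub (summable_fourier hd γ)

theorem fourier_single (m : M) (z : ℂ) (γ : AddChar M Circle) :
    fourier M (Finsupp.single m z) γ = z * conj ((γ m : Circle) : ℂ) := by
  classical
  rw [fourier, tsum_eq_single m]
  · simp
  · intro b hb
    simp [hb.symm]

theorem summable_norm_finsupp {ι : Type*} (d : ι →₀ ℂ) : Summable fun m => ‖d m‖ :=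
  summable_of_ne_finset_zero (s := d.support) fun b hb => by simpa using hb

theorem coe_addChar_sub (γ : AddChar M Circle) (a b : M) :
    ((γ (a - b) : Circle) : ℂ) = (γ a : ℂ) * conj ((γ b : Circle) : ℂ) := by
  rw [AddChar.map_sub_eq_div, Circle.coe_div, div_eq_mul_inv, ← Circle.coe_inv,
    Circle.coe_inv_eq_conj]

/-- Trigonometric polynomials are uniformly dense in the continuous functions on the dual. -/
theorem exists_fourier_approx (φ : AddChar M Circle → ℂ) (hφ : Continuous φ) {ε : ℝ}
    (hε : 0 < ε) : ∃ d : M →₀ ℂ, ∀ γ, ‖fourier M d γ - φ γ‖ < ε := by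
  let e : M → C(AddChar M Circle, ℂ) := fun m =>
    ⟨fun γ => conj ((γ m : Circle) : ℂ), Complex.continuous_conj.comp (continuous_addChar_coe m)⟩
  -- The linear span is already a star algebra, since `e m * e n = e (m + n)` and `star (e m) = e
  -- (-m)`; its elements are thus transforms of finitely supported `d`.
  let S : StarSubalgebra ℂ C(AddChar M Circle, ℂ) :=
    { carrier := Submodule.span ℂ (Set.range e)
      mul_mem' := by
        intro a b ha hb
        have hm := Submodule.mul_mem_mul ha hb
        rw [Submodule.span_mul_span] at hm
        refine Submodule.span_mono ?_ hm
        rintro _ ⟨_, ⟨m, rfl⟩, _, ⟨n, rfl⟩, rfl⟩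
        exact ⟨m + n, by ext γ; simp [e, AddChar.map_add_eq_mul]⟩
      one_mem' := Submodule.subset_span ⟨0, by ext γ; simp [e]⟩
      add_mem' := fun ha hb => add_mem ha hb
      zero_mem' := zero_mem _
      algebraMap_mem' := fun r => by
        rw [Algebra.algebraMap_eq_smul_one]
        exact Submodule.smul_mem _ _ (Submodule.subset_span ⟨0, by ext γ; simp [e]⟩)
      star_mem' := by
        intro a ha
        simp only [SetLike.mem_coe] at ha ⊢
        induction ha using Submodule.span_induction with
        | mem x hx =>
          obtain ⟨m, rfl⟩ := hx
          refine Submodule.subset_span ⟨-m, ?_⟩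
          ext γ
          simp only [e, ContinuousMap.coe_mk, ContinuousMap.star_apply, AddChar.map_neg_eq_inv,
            Circle.coe_inv_eq_conj]
          rfl
        | zero => simp
        | add x y _ _ hx hy => rw [star_add]; exact add_mem hx hy
        | smul z x _ hx => rw [star_smul]; exact Submodule.smul_mem _ _ hx }
  have hsep : S.SeparatesPoints := by
    intro γ γ' hne
    obtain ⟨m, hm⟩ := DFunLike.ne_iff.mp hne
    refine ⟨e m, ⟨e m, Submodule.subset_span ⟨m, rfl⟩, rfl⟩, fun h => hm ?_⟩
    ext
    exact (starRingEnd ℂ).injective h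
  have htop := ContinuousMap.starSubalgebra_topologicalClosure_eq_top_of_separatesPoints S hsep
  have hmem : (⟨φ, hφ⟩ : C(AddChar M Circle, ℂ)) ∈ closure (S : Set C(AddChar M Circle, ℂ)) := by
    rw [← StarSubalgebra.topologicalClosure_coe, htop]; trivial
  obtain ⟨p, hp, hdist⟩ := Metric.mem_closure_iff.mp hmem ε hε
  obtain ⟨d, rfl⟩ := Finsupp.mem_span_range_iff_exists_finsupp.mp hp
  refine ⟨d, fun γ => ?_⟩
  have h1 : fourier M d γ = (d.sum fun i a => a • e i) γ := by
    rw [fourier, tsum_eq_sum (s := d.support) fun b hb => by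
      rw [Finsupp.notMem_support_iff.mp hb, zero_mul]]
    rw [Finsupp.sum, ContinuousMap.sum_apply]
    rfl
  rw [h1, ← dist_eq_norm, dist_comm]
  exact lt_of_le_of_lt (ContinuousMap.dist_apply_le_dist (f := ⟨φ, hφ⟩) γ) hdist

variable [Countable M]

/-- Fourier inversion: absolute summability permits termwise integration, and orthogonality of
characters leaves one term. -/
theorem integral_fourier_mul {c : M → ℂ} (hc : Summable fun m => ‖c m‖) (a : M) :
    ∫ γ, ((γ a : Circle) : ℂ) * fourier M c γ ∂(dualHaar M) = c a := by
  classical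
  have key := hasSum_integral_of_summable_integral_norm (μ := dualHaar M)
    (F := fun (m : M) (γ : AddChar M Circle) =>
      ((γ a : Circle) : ℂ) * (c m * conj ((γ m : Circle) : ℂ)))
    (fun m => integrable_of_continuous ((continuous_addChar_coe a).mul
      (continuous_const.mul (Complex.continuous_conj.comp (continuous_addChar_coe m)))))
    (by simpa [Circle.norm_coe] using hc)
  have h2 : ∀ m : M, ∫ γ, ((γ a : Circle) : ℂ) * (c m * conj ((γ m : Circle) : ℂ)) ∂(dualHaar M)
      = if m = a then c a else 0 := by
    intro m
    have : ∀ γ : AddChar M Circle, ((γ a : Circle) : ℂ) * (c m * conj ((γ m : Circle) : ℂ))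
        = c m * ((γ (a - m) : Circle) : ℂ) := fun γ => by rw [coe_addChar_sub]; ring
    simp_rw [this]
    rw [integral_const_mul, integral_addChar]
    by_cases h : m = a
    · simp [h]
    · simp [h, sub_eq_zero, Ne.symm h]
  simp_rw [h2] at key
  have h3 := key.unique (hasSum_ite_eq a (c a))
  rw [← h3]
  refine integral_congr_ae (ae_of_all _ fun γ => ?_)
  simp only [fourier, tsum_mul_left]

/-- Plancherel's formula for absolutely summable sequences. -/
theorem integral_norm_sq_fourier {c : M → ℂ} (hc : Summable fun m => ‖c m‖) :
    HasSum (fun m => ‖c m‖ ^ 2) (∫ γ, ‖fourier M c γ‖ ^ 2 ∂(dualHaar M)) := by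
  obtain ⟨C, hC⟩ : ∃ C, ∀ γ, ‖fourier M c γ‖ ≤ C := ⟨∑' m, ‖c m‖, fun γ => by
    refine (norm_tsum_le_tsum_norm ?_).trans (by simp only [norm_mul_conj_char]; rfl)
    simpa only [norm_mul_conj_char] using hc⟩
  have hcont : ∀ m : M, Continuous fun γ : AddChar M Circle =>
      conj (c m) * (((γ m : Circle) : ℂ) * fourier M c γ) := fun m =>
    continuous_const.mul ((continuous_addChar_coe m).mul (continuous_fourier hc))
  -- Only the conjugated factor of `conj ĉ * ĉ` is expanded; inversion then evaluates each term as
  -- `conj (c m) * c m`.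
  have key := hasSum_integral_of_summable_integral_norm (μ := dualHaar M)
    (F := fun (m : M) (γ : AddChar M Circle) =>
      conj (c m) * (((γ m : Circle) : ℂ) * fourier M c γ))
    (fun m => integrable_of_continuous (hcont m))
    (by
      refine Summable.of_nonneg_of_le (fun m => integral_nonneg fun γ => norm_nonneg _) (fun m => ?_)
        (hc.mul_right C)
      refine (integral_mono (integrable_of_continuous (hcont m).norm) (integrable_const _)
        fun γ => ?_).trans_eq (by simp : ∫ _, ‖c m‖ * C ∂(dualHaar M) = ‖c m‖ * C)
      simp only [norm_mul, RCLike.norm_conj, Circle.norm_coe, one_mul]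
      exact mul_le_mul_of_nonneg_left (hC γ) (norm_nonneg _))
  simp_rw [integral_const_mul, integral_fourier_mul hc] at key
  have hre := Complex.hasSum_re key
  convert hre using 1
  · ext m
    rw [mul_comm, Complex.mul_conj, Complex.ofReal_re, Complex.normSq_eq_norm_sq]
  · have : ∀ γ, ∑' m : M, conj (c m) * (((γ m : Circle) : ℂ) * fourier M c γ)
        = ((‖fourier M c γ‖ ^ 2 : ℝ) : ℂ) := by
      intro γ
      have h1 : ∀ m : M, conj (c m) * (((γ m : Circle) : ℂ) * fourier M c γ)
        = conj (c m * conj ((γ m : Circle) : ℂ)) * fourier M c γ := fun m => by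
          simp [mul_assoc]
      simp_rw [h1]
      rw [tsum_mul_right, ← Complex.conj_tsum]
      change conj (fourier M c γ) * fourier M c γ = _
      rw [mul_comm, Complex.mul_conj, Complex.normSq_eq_norm_sq]
    simp_rw [this]
    rw [integral_complex_ofReal, Complex.ofReal_re]

end Fourier

/-! ### Plancherel on `G` through the cosets of `M` -/

section Cosets

theorem summable_ell_one {J : Type*} (f : ell 1 J) : Summable fun n => ‖f n‖ := by
  simpa using (lp.memℓp f).summable (p := 1) (by norm_num)

variable {G : Type*} [AddCommGroup G] {M : AddSubgroup G} {κ : Type*}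

/-- The decomposition of `G` into the cosets `M + l i` of `M`. -/
def cosetEquiv (l : κ → G)
    (hl : Function.Bijective fun i => (QuotientAddGroup.mk (l i) : G ⧸ M)) : κ × M ≃ G :=
  Equiv.ofBijective (fun p => (p.2 : G) + l p.1) <| by
    constructor
    · rintro ⟨i, m⟩ ⟨j, n⟩ h
      have hij : i = j := hl.1 <| by
        refine (QuotientAddGroup.eq (s := M)).mpr ?_
        have : -l i + l j = ((m - n : M) : G) := by
          simp only at h
          rw [AddSubgroup.coe_sub, neg_add_eq_sub, sub_eq_sub_iff_add_eq_add, add_comm (l j),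
            ← h, add_comm]
        rw [this]
        exact (m - n).2
      subst hij
      have := add_right_cancel h
      simpa [Prod.ext_iff] using this
    · intro g
      obtain ⟨i, hi⟩ := hl.2 (g : G ⧸ M)
      have hi' := (QuotientAddGroup.eq (s := M)).mp hi
      exact ⟨(i, ⟨-l i + g, hi'⟩), by simp⟩

@[simp]
theorem cosetEquiv_apply (l : κ → G)
    (hl : Function.Bijective fun i => (QuotientAddGroup.mk (l i) : G ⧸ M)) (p : κ × M) :
    cosetEquiv l hl p = (p.2 : G) + l p.1 := rfl

theorem ell_two_norm_sq {ι : Type*} (x : ell 2 ι) : ‖x‖ ^ 2 = ∑' n, ‖x n‖ ^ 2 := by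
  have := lp.norm_rpow_eq_tsum (p := 2) (by norm_num) x
  simpa using this

theorem summable_comp_coset {F : G → ℂ} (hF : Summable fun n => ‖F n‖) (t : G) :
    Summable fun m : M => ‖F ((m : G) + t)‖ :=
  hF.comp_injective (i := fun m : M => (m : G) + t)
    fun _ _ h => Subtype.ext (add_right_cancel h)

variable [Fintype κ] [Countable M]

/-- Plancherel's formula on `G`, in terms of the `M`-Fourier transforms along the cosets. -/
theorem norm_sq_eq_integral_cosets (l : κ → G)
    (hl : Function.Bijective fun i => (QuotientAddGroup.mk (l i) : G ⧸ M))
    (x : ell 2 G) (hx : Summable fun n => ‖x n‖) :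
    ‖x‖ ^ 2 = ∫ γ, ∑ j, ‖fourier M (fun m => x ((m : G) + l j)) γ‖ ^ 2 ∂(dualHaar M) := by
  have hs : ∀ j, Summable fun m : M => ‖x ((m : G) + l j)‖ := fun j => summable_comp_coset hx _
  have hint : ∀ j ∈ Finset.univ, Integrable
      (fun γ => ‖fourier M (fun m => x ((m : G) + l j)) γ‖ ^ 2) (dualHaar M) :=
    fun j _ => integrable_of_continuous ((continuous_fourier (hs j)).norm.pow 2)
  rw [integral_finsetSum _ hint, ell_two_norm_sq]
  have h1 : ∀ j, ∫ γ, ‖fourier M (fun m => x ((m : G) + l j)) γ‖ ^ 2 ∂(dualHaar M) =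
      ∑' m : M, ‖x ((m : G) + l j)‖ ^ 2 := fun j => (integral_norm_sq_fourier (hs j)).tsum_eq.symm
  have h2 : Summable fun n => ‖x n‖ ^ 2 := by
    simpa using (lp.memℓp x).summable (p := 2) (by norm_num)
  have h3 : Summable fun p : κ × M => ‖x ((p.2 : G) + l p.1)‖ ^ 2 :=
    h2.comp_injective (cosetEquiv l hl).injective
  rw [← (cosetEquiv l hl).tsum_eq fun n => ‖x n‖ ^ 2]
  simp only [cosetEquiv_apply]
  rw [h3.tsum_prod, tsum_fintype]
  exact Finset.sum_congr rfl fun j _ => (h1 j).symm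

end Cosets

/-! ### Synthesis as multiplication by the adjoint polyphase matrix -/

section Synthesis

variable {G : Type*} [AddCommGroup G] {M : AddSubgroup G} {κ : Type*}

/-- The vector of the `M`-Fourier transforms of a finite family of coefficients. -/
def coeffFourier (c : κ × M →₀ ℂ) (γ : AddChar M Circle) : κ → ℂ :=
  fun k => fourier M (fun m => c (k, m)) γ

/-- The finite linear combinations of the translates `T_m f_k`. -/
def synthesis (h : κ → ell 1 G) (c : κ × M →₀ ℂ) : ell 2 G :=
  c.sum fun p z => z • translates M h p

theorem translates_apply (h : κ → ell 1 G) (p : κ × M) (n : G) :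
    translates M h p n = conj (h p.1 ((p.2 : G) - n)) := by
  change conj (h p.1 (-(n - p.2))) = _
  rw [neg_sub]

theorem summable_translates (h : κ → ell 1 G) (p : κ × M) :
    Summable fun n => ‖translates M h p n‖ := by
  simp only [translates_apply, RCLike.norm_conj]
  exact (Equiv.subLeft (p.2 : G)).summable_iff.mpr (summable_ell_one (h p.1))

theorem synthesis_add (h : κ → ell 1 G) (c d : κ × M →₀ ℂ) :
    synthesis h (c + d) = synthesis h c + synthesis h d := by
  classical
  exact Finsupp.sum_add_index' (by simp) (by simp [add_smul])

theorem synthesis_single (h : κ → ell 1 G) (p : κ × M) (z : ℂ) :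
    synthesis h (Finsupp.single p z) = z • translates M h p :=
  Finsupp.sum_single_index (by simp)

theorem synthesis_zero (h : κ → ell 1 G) : synthesis h (0 : κ × M →₀ ℂ) = 0 :=
  Finsupp.sum_zero_index

theorem summable_synthesis (h : κ → ell 1 G) (c : κ × M →₀ ℂ) :
    Summable fun n => ‖synthesis h c n‖ := by
  induction c using Finsupp.induction_linear with
  | zero => simp [synthesis_zero, summable_zero]
  | add c d hc hd =>
    rw [synthesis_add]
    exact Summable.of_nonneg_of_le (fun _ => norm_nonneg _) (fun n => norm_add_le _ _) (hc.add hd)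
  | single p z =>
    rw [synthesis_single]
    simpa using (summable_translates h p).mul_left ‖z‖

theorem summable_coeff_slice (c : κ × M →₀ ℂ) (k : κ) : Summable fun m : M => ‖c (k, m)‖ :=
  (summable_norm_finsupp c).comp_injective (Prod.mk_right_injective k)

theorem summable_polyphase {ι : Type*} (h : κ → ell 1 G) (l : ι → G) (k : κ) (j : ι) :
    Summable fun m : M => ‖h k ((m : G) - l j)‖ := by
  simpa only [sub_eq_add_neg] using summable_comp_coset (summable_ell_one (h k)) (-l j)

theorem coeffFourier_add (c d : κ × M →₀ ℂ) (γ : AddChar M Circle) :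
    coeffFourier (c + d) γ = coeffFourier c γ + coeffFourier d γ := by
  ext k
  exact fourier_add (summable_coeff_slice c k) (summable_coeff_slice d k) γ

theorem coeffFourier_single [DecidableEq κ] (k : κ) (m : M) (z : ℂ) (γ : AddChar M Circle) :
    coeffFourier (Finsupp.single (k, m) z) γ = Pi.single k (z * conj ((γ m : Circle) : ℂ)) := by
  classical
  ext k'
  rw [coeffFourier]
  by_cases hk : k = k'
  · subst hk
    rw [Pi.single_eq_same, ← fourier_single m z γ]
    congr 1
    ext m'
    simp [Finsupp.single_apply]
  · rw [Pi.single_eq_of_ne (Ne.symm hk)]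
    simp [fourier, hk]

/-- The substitution `m' = m - n` undoes the reflection in `f_k`; the conjugation in `f_k` is what
makes the adjoint of the polyphase matrix appear. -/
theorem fourier_translates {ι : Type*} (h : κ → ell 1 G) (l : ι → G) (k : κ) (m : M) (j : ι)
    (γ : AddChar M Circle) :
    fourier M (fun m' => translates M h (k, m) ((m' : G) + l j)) γ =
      conj ((γ m : Circle) : ℂ) * conj (polyphase M h l γ k j) := by
  simp only [translates_apply, fourier, polyphase, Matrix.of_apply]
  rw [← map_mul, ← tsum_mul_left, Complex.conj_tsum, ← (Equiv.subLeft m).tsum_eq]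
  refine tsum_congr fun n => ?_
  rw [Equiv.subLeft_apply, coe_addChar_sub]
  have : (m : G) - (((m - n : M) : G) + l j) = (n : G) - l j := by
    push_cast; abel
  rw [this]
  simp only [map_mul, Complex.conj_conj]
  ring

theorem continuous_coeffFourier (c : κ × M →₀ ℂ) : Continuous (coeffFourier c) :=
  continuous_pi fun k => continuous_fourier (summable_coeff_slice c k)

theorem continuous_polyphase {ι : Type*} (h : κ → ell 1 G) (l : ι → G) :
    Continuous (polyphase M h l) :=
  continuous_matrix fun k j => continuous_fourier (summable_polyphase h l k j)

variable [Fintype κ]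

/-- On the Fourier side, synthesis is multiplication by the adjoint of the polyphase matrix. -/
theorem fourier_synthesis {ι : Type*} (h : κ → ell 1 G) (l : ι → G) (c : κ × M →₀ ℂ) (j : ι)
    (γ : AddChar M Circle) :
    fourier M (fun m => synthesis h c ((m : G) + l j)) γ =
      ((polyphase M h l γ)ᴴ *ᵥ coeffFourier c γ) j := by
  classical
  induction c using Finsupp.induction_linear with
  | zero =>
    have : coeffFourier (0 : κ × M →₀ ℂ) γ = 0 := by ext k; simp [coeffFourier, fourier]
    simp [synthesis_zero, fourier, this]
  | add c d hc hd =>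
    rw [synthesis_add, coeffFourier_add, Matrix.mulVec_add, Pi.add_apply, ← hc, ← hd]
    exact fourier_add (summable_comp_coset (summable_synthesis h c) _)
      (summable_comp_coset (summable_synthesis h d) _) γ
  | single p z =>
    obtain ⟨k, m⟩ := p
    rw [synthesis_single, coeffFourier_single]
    have h1 : fourier M (fun m' => (z • translates M h (k, m)) ((m' : G) + l j)) γ =
        z * fourier M (fun m' => translates M h (k, m) ((m' : G) + l j)) γ := by
      simp only [fourier, ← tsum_mul_left]
      refine tsum_congr fun n => ?_
      rw [lp.coeFn_smul, Pi.smul_apply, smul_eq_mul, mul_assoc]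
    rw [h1, fourier_translates, Matrix.mulVec_single]
    simp [Matrix.conjTranspose_apply]
    ring

/-- Continuous vector functions on the dual are uniform limits of trigonometric polynomials. -/
theorem exists_coeffFourier_approx (w : AddChar M Circle → κ → ℂ) (hw : Continuous w) {ε : ℝ}
    (hε : 0 < ε) : ∃ c : κ × M →₀ ℂ, ∀ γ k, ‖coeffFourier c γ k - w γ k‖ < ε := by
  choose d hd using fun k => exists_fourier_approx (fun γ => w γ k)
    ((continuous_apply k).comp hw) hε
  refine ⟨Finsupp.ofSupportFinite (fun p => d p.1 p.2) ?_, fun γ k => hd k γ⟩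
  refine (Set.finite_iUnion fun k => ((d k).hasFiniteSupport.image (Prod.mk k))).subset ?_
  rintro ⟨k, m⟩ hp
  exact Set.mem_iUnion.mpr ⟨k, m, hp, rfl⟩

variable [Countable M]

theorem integral_coeffFourier (c : κ × M →₀ ℂ) :
    ∫ γ, ∑ k, ‖coeffFourier c γ k‖ ^ 2 ∂(dualHaar M) = c.sum fun _ z => ‖z‖ ^ 2 := by
  have hint : ∀ k ∈ Finset.univ, Integrable (fun γ => ‖coeffFourier c γ k‖ ^ 2) (dualHaar M) :=
    fun k _ => integrable_of_continuous
      (((continuous_apply k).comp (continuous_coeffFourier c)).norm.pow 2)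
  rw [integral_finsetSum _ hint]
  simp_rw [coeffFourier, fun k => (integral_norm_sq_fourier (summable_coeff_slice c k)).tsum_eq.symm]
  have h3 : Summable fun p : κ × M => ‖c p‖ ^ 2 :=
    summable_of_ne_finset_zero (s := c.support) fun b hb => by simpa using hb
  rw [← tsum_fintype (L := SummationFilter.unconditional κ), ← h3.tsum_prod,
    tsum_eq_sum (s := c.support) fun b hb => by simpa using hb]
  rfl

theorem norm_sq_synthesis (h : κ → ell 1 G) (l : κ → G)
    (hl : Function.Bijective fun i => (QuotientAddGroup.mk (l i) : G ⧸ M)) (c : κ × M →₀ ℂ) :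
    ‖synthesis h c‖ ^ 2 =
      ∫ γ, ∑ j, ‖((polyphase M h l γ)ᴴ *ᵥ coeffFourier c γ) j‖ ^ 2 ∂(dualHaar M) := by
  rw [norm_sq_eq_integral_cosets l hl _ (summable_synthesis h c)]
  simp only [fourier_synthesis]

end Synthesis

/-! ### Extreme eigenvalues by Rayleigh quotients -/

section Rayleigh

open scoped ComplexOrder

variable {κ : Type*} [Fintype κ]

theorem sum_norm_sq_mulVec (H : Matrix κ κ ℂ) (v : κ → ℂ) :
    ((∑ j, ‖(H *ᵥ v) j‖ ^ 2 : ℝ) : ℂ) = star v ⬝ᵥ ((Hᴴ * H) *ᵥ v) := by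
  rw [← Matrix.mulVec_mulVec, Matrix.dotProduct_mulVec, Matrix.vecMul_conjTranspose, star_star]
  simp [dotProduct, ← Complex.conj_mul']

theorem sum_norm_sq_repr (b : OrthonormalBasis κ ℂ (EuclideanSpace ℂ κ)) (v : κ → ℂ) :
    ∑ i, ‖b.repr (WithLp.toLp 2 v) i‖ ^ 2 = ∑ i, ‖v i‖ ^ 2 := by
  rw [← EuclideanSpace.norm_sq_eq, b.repr.norm_map, EuclideanSpace.norm_sq_eq]

theorem continuous_sum_norm_sq_mulVec {X : Type*} [TopologicalSpace X] {Q : X → Matrix κ κ ℂ} (hQ : Continuous Q) :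
    Continuous fun p : X × EuclideanSpace ℂ κ => ∑ j, ‖(Q p.1 *ᵥ p.2) j‖ ^ 2 := by
  refine continuous_finsetSum _ fun j _ => Continuous.pow (Continuous.norm ?_) 2
  have hv : Continuous fun p : X × EuclideanSpace ℂ κ => (p.2 : κ → ℂ) :=
    (PiLp.continuous_ofLp 2 _).comp continuous_snd
  exact (continuous_apply j).comp ((hQ.comp continuous_fst).matrix_mulVec hv)

theorem sum_norm_sq_eq_one_of_mem_sphere {v : EuclideanSpace ℂ κ}
    (hv : v ∈ Metric.sphere (0 : EuclideanSpace ℂ κ) 1) : ∑ i, ‖v i‖ ^ 2 = 1 := by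
  rw [← EuclideanSpace.norm_sq_eq, mem_sphere_zero_iff_norm.mp hv, one_pow]

theorem sum_norm_sq_mulVec_smul (H : Matrix κ κ ℂ) (t : ℝ) (v : κ → ℂ) :
    ∑ j, ‖(H *ᵥ ((t : ℂ) • v)) j‖ ^ 2 = t ^ 2 * ∑ j, ‖(H *ᵥ v) j‖ ^ 2 := by
  simp [Matrix.mulVec_smul, mul_pow, Finset.mul_sum]

/-- Every vector is a nonnegative multiple of a unit vector. -/
theorem exists_smul_unit [Nonempty κ] (v : κ → ℂ) :
    ∃ u ∈ Metric.sphere (0 : EuclideanSpace ℂ κ) 1,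
    ∃ t : ℝ, v = (t : ℂ) • (u : κ → ℂ) ∧ ∑ i, ‖v i‖ ^ 2 = t ^ 2 := by
  by_cases hv : v = 0
  · obtain ⟨u, hu⟩ : (Metric.sphere (0 : EuclideanSpace ℂ κ) 1).Nonempty :=
      NormedSpace.sphere_nonempty.mpr zero_le_one
    exact ⟨u, hu, 0, by simp [hv], by simp [hv]⟩
  · have hn : ‖WithLp.toLp 2 v‖ ≠ 0 := by simpa using hv
    refine ⟨((‖WithLp.toLp 2 v‖⁻¹ : ℝ) : ℂ) • WithLp.toLp 2 v, ?_, ‖WithLp.toLp 2 v‖, ?_, ?_⟩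
    · rw [mem_sphere_zero_iff_norm, norm_smul, Complex.norm_real, norm_inv, norm_norm,
        inv_mul_cancel₀ hn]
    · rw [WithLp.ofLp_smul, smul_smul, ← Complex.ofReal_mul, mul_inv_cancel₀ hn]
      simp
    · rw [EuclideanSpace.norm_sq_eq]

variable [DecidableEq κ]

theorem sum_norm_sq_mulVec_eq_sum_eigenvalues (H : Matrix κ κ ℂ) (v : κ → ℂ) :
    ∑ j, ‖(H *ᵥ v) j‖ ^ 2 =
      ∑ i, (Matrix.isHermitian_conjTranspose_mul_self H).eigenvalues i *
        ‖((Matrix.isHermitian_conjTranspose_mul_self H).eigenvectorBasis).repr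
          (WithLp.toLp 2 v) i‖ ^ 2 := by
  set hA := Matrix.isHermitian_conjTranspose_mul_self H
  set b := hA.eigenvectorBasis
  have hv : v = ∑ i, b.repr (WithLp.toLp 2 v) i • (b i : κ → ℂ) := by
    have := congrArg WithLp.ofLp (b.sum_repr (WithLp.toLp 2 v))
    simpa using this.symm
  have hmul : (Hᴴ * H) *ᵥ v = WithLp.ofLp
      (∑ i, ((hA.eigenvalues i : ℂ) * b.repr (WithLp.toLp 2 v) i) • b i) := by
    conv_lhs => rw [hv]
    rw [Matrix.mulVec_sum]
    simp only [WithLp.ofLp_sum, WithLp.ofLp_smul]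
    refine Finset.sum_congr rfl fun i _ => ?_
    rw [Matrix.mulVec_smul, hA.mulVec_eigenvectorBasis, mul_comm, mul_smul]
    rfl
  have key := sum_norm_sq_mulVec H v
  have hin : star v ⬝ᵥ ((Hᴴ * H) *ᵥ v) = inner ℂ (WithLp.toLp 2 v)
      (∑ i, ((hA.eigenvalues i : ℂ) * b.repr (WithLp.toLp 2 v) i) • b i) := by
    rw [hmul, EuclideanSpace.inner_eq_star_dotProduct, dotProduct_comm]
  rw [hin, inner_sum] at key
  have : ∀ i, inner ℂ (WithLp.toLp 2 v) (((hA.eigenvalues i : ℂ) * b.repr (WithLp.toLp 2 v) i) • b i)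
      = ((hA.eigenvalues i * ‖b.repr (WithLp.toLp 2 v) i‖ ^ 2 : ℝ) : ℂ) := by
    intro i
    rw [inner_smul_right, ← inner_conj_symm, ← b.repr_apply_apply, mul_assoc, Complex.mul_conj,
      Complex.normSq_eq_norm_sq]
    push_cast
    rfl
  simp_rw [this] at key
  exact_mod_cast key

/-- In an eigenbasis of `Hᴴ * H` the quadratic form is a weighted sum of squares; the converse tests
it on eigenvectors. This form avoids any continuity statement about eigenvalues. -/
theorem le_lambdaMin_iff [Nonempty κ] (H : Matrix κ κ ℂ) (a : ℝ) :
    a ≤ lambdaMin H ↔ ∀ v : κ → ℂ, a * ∑ i, ‖v i‖ ^ 2 ≤ ∑ j, ‖(H *ᵥ v) j‖ ^ 2 := by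
  set hA := Matrix.isHermitian_conjTranspose_mul_self H with hAdef
  constructor
  · intro h v
    rw [sum_norm_sq_mulVec_eq_sum_eigenvalues, ← sum_norm_sq_repr hA.eigenvectorBasis v,
      Finset.mul_sum]
    refine Finset.sum_le_sum fun i _ => mul_le_mul_of_nonneg_right ?_ (by positivity)
    exact h.trans (ciInf_le (Set.finite_range _).bddBelow i)
  · intro h
    refine le_ciInf fun i => ?_
    have := h (hA.eigenvectorBasis i)
    rw [sum_norm_sq_mulVec_eq_sum_eigenvalues, ← sum_norm_sq_repr hA.eigenvectorBasis] at this
    simpa [PiLp.single_apply, ← hAdef, apply_ite] using this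

theorem lambdaMax_le_iff [Nonempty κ] (H : Matrix κ κ ℂ) (b : ℝ) :
    lambdaMax H ≤ b ↔ ∀ v : κ → ℂ, ∑ j, ‖(H *ᵥ v) j‖ ^ 2 ≤ b * ∑ i, ‖v i‖ ^ 2 := by
  set hA := Matrix.isHermitian_conjTranspose_mul_self H with hAdef
  constructor
  · intro h v
    rw [sum_norm_sq_mulVec_eq_sum_eigenvalues, ← sum_norm_sq_repr hA.eigenvectorBasis v,
      Finset.mul_sum]
    refine Finset.sum_le_sum fun i _ => mul_le_mul_of_nonneg_right ?_ (by positivity)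
    exact (le_ciSup (Set.finite_range _).bddAbove i).trans h
  · intro h
    refine ciSup_le fun i => ?_
    have := h (hA.eigenvectorBasis i)
    rw [sum_norm_sq_mulVec_eq_sum_eigenvalues, ← sum_norm_sq_repr hA.eigenvectorBasis] at this
    simpa [PiLp.single_apply, ← hAdef, apply_ite] using this

/-- For square `H`, `H * Hᴴ` and `Hᴴ * H` share their characteristic polynomial. Synthesis produces
the former, the claimed bounds use the latter. -/
theorem eigenvalues_conjTranspose_mul_self (H : Matrix κ κ ℂ) :
    (Matrix.isHermitian_conjTranspose_mul_self Hᴴ).eigenvalues =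
      (Matrix.isHermitian_conjTranspose_mul_self H).eigenvalues := by
  rw [Matrix.IsHermitian.eigenvalues_eq_eigenvalues_iff, Matrix.conjTranspose_conjTranspose,
    Matrix.charpoly_mul_comm]

theorem lambdaMin_conjTranspose (H : Matrix κ κ ℂ) : lambdaMin Hᴴ = lambdaMin H := by
  rw [lambdaMin, lambdaMin, eigenvalues_conjTranspose_mul_self]

theorem lambdaMax_conjTranspose (H : Matrix κ κ ℂ) : lambdaMax Hᴴ = lambdaMax H := by
  rw [lambdaMax, lambdaMax, eigenvalues_conjTranspose_mul_self]

variable {X : Type*} [TopologicalSpace X] [CompactSpace X] [Nonempty X] [Nonempty κ]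

/-- The least eigenvalue of a continuous matrix field attains its minimum on a compact space. -/
theorem exists_isLeast_lambdaMin {Q : X → Matrix κ κ ℂ} (hQ : Continuous Q) :
    ∃ A, IsLeast (Set.range fun x => lambdaMin (Q x)) A := by
  have hne : ((Set.univ : Set X) ×ˢ Metric.sphere (0 : EuclideanSpace ℂ κ) 1).Nonempty :=
    Set.univ_nonempty.prod (NormedSpace.sphere_nonempty.mpr zero_le_one)
  -- Minimizing jointly over points and unit vectors gives a value below every `lambdaMin (Q x)`
  -- and, tested at `v₀`, above `lambdaMin (Q x₀)`.
  obtain ⟨⟨x₀, v₀⟩, ⟨-, hv₀⟩, hmin⟩ := (isCompact_univ.prod (isCompact_sphere _ _)).exists_isMinOn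
    hne (continuous_sum_norm_sq_mulVec hQ).continuousOn
  rw [isMinOn_iff] at hmin
  have hle : ∀ x, ∑ j, ‖(Q x₀ *ᵥ v₀) j‖ ^ 2 ≤ lambdaMin (Q x) := fun x => by
    rw [le_lambdaMin_iff]
    intro v
    obtain ⟨u, hu, t, rfl, ht⟩ := exists_smul_unit v
    rw [ht, sum_norm_sq_mulVec_smul, mul_comm]
    exact mul_le_mul_of_nonneg_left (hmin (x, u) (Set.mk_mem_prod (Set.mem_univ x) hu)) (sq_nonneg t)
  refine ⟨lambdaMin (Q x₀), ⟨x₀, rfl⟩, ?_⟩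
  rintro _ ⟨x, rfl⟩
  refine le_trans ?_ (hle x)
  have := (le_lambdaMin_iff (Q x₀) _).mp le_rfl v₀
  rwa [sum_norm_sq_eq_one_of_mem_sphere hv₀, mul_one] at this

/-- The largest eigenvalue of a continuous matrix field attains its maximum on a compact space. -/
theorem exists_isGreatest_lambdaMax {Q : X → Matrix κ κ ℂ} (hQ : Continuous Q) :
    ∃ B, IsGreatest (Set.range fun x => lambdaMax (Q x)) B := by
  have hne : ((Set.univ : Set X) ×ˢ Metric.sphere (0 : EuclideanSpace ℂ κ) 1).Nonempty :=
    Set.univ_nonempty.prod (NormedSpace.sphere_nonempty.mpr zero_le_one)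
  obtain ⟨⟨x₀, v₀⟩, ⟨-, hv₀⟩, hmax⟩ := (isCompact_univ.prod (isCompact_sphere _ _)).exists_isMaxOn
    hne (continuous_sum_norm_sq_mulVec hQ).continuousOn
  rw [isMaxOn_iff] at hmax
  have hle : ∀ x, lambdaMax (Q x) ≤ ∑ j, ‖(Q x₀ *ᵥ v₀) j‖ ^ 2 := fun x => by
    rw [lambdaMax_le_iff]
    intro v
    obtain ⟨u, hu, t, rfl, ht⟩ := exists_smul_unit v
    rw [ht, sum_norm_sq_mulVec_smul, mul_comm _ (t ^ 2)]
    exact mul_le_mul_of_nonneg_left (hmax (x, u) (Set.mk_mem_prod (Set.mem_univ x) hu)) (sq_nonneg t)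
  refine ⟨lambdaMax (Q x₀), ⟨x₀, rfl⟩, ?_⟩
  rintro _ ⟨x, rfl⟩
  refine (hle x).trans ?_
  have := (lambdaMax_le_iff (Q x₀) _).mp le_rfl v₀
  rwa [sum_norm_sq_eq_one_of_mem_sphere hv₀, mul_one] at this

/-- A kernel vector defeats a positive lower bound; conversely a zero eigenvalue kills `det (Hᴴ * H)
= |det H|²`. -/
theorem lambdaMin_pos_iff (H : Matrix κ κ ℂ) : 0 < lambdaMin H ↔ H.det ≠ 0 := by
  constructor
  · intro h hdet
    obtain ⟨v, hv, hv0⟩ := Matrix.exists_mulVec_eq_zero_iff.mpr hdet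
    have := (le_lambdaMin_iff H _).mp le_rfl v
    rw [hv0] at this
    simp only [Pi.zero_apply, norm_zero, ne_eq, OfNat.ofNat_ne_zero, not_false_eq_true, zero_pow,
      Finset.sum_const_zero] at this
    obtain ⟨i, hi⟩ := Function.ne_iff.mp hv
    have hpos : 0 < ∑ i, ‖v i‖ ^ 2 := Finset.sum_pos' (fun _ _ => by positivity)
      ⟨i, Finset.mem_univ _, by have := norm_pos_iff.mpr hi; positivity⟩
    nlinarith
  · intro hdet
    obtain ⟨i, hi⟩ := exists_eq_ciInf_of_finite
      (f := (Matrix.isHermitian_conjTranspose_mul_self H).eigenvalues)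
    rw [lambdaMin, ← hi]
    refine lt_of_le_of_ne ((Matrix.posSemidef_conjTranspose_mul_self H).eigenvalues_nonneg i)
      fun h0 => hdet ?_
    have hd := (Matrix.isHermitian_conjTranspose_mul_self H).det_eq_prod_eigenvalues
    rw [Finset.prod_eq_zero (Finset.mem_univ i) (by simp [← h0]), Matrix.det_mul,
      Matrix.det_conjTranspose] at hd
    simpa using hd

theorem lambdaMin_le_lambdaMax (H : Matrix κ κ ℂ) : lambdaMin H ≤ lambdaMax H :=
  ciInf_le_ciSup (Set.finite_range _).bddBelow (Set.finite_range _).bddAbove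

end Rayleigh

/-! ### From Riesz bounds and completeness to Riesz bases -/

section RieszSequences

variable {E : Type*} [NormedAddCommGroup E] [InnerProductSpace ℂ E] {ι : Type*}

theorem norm_sq_sum_orthonormal {e : ι → E} (he : Orthonormal ℂ e) (c : ι →₀ ℂ) :
    ‖c.sum fun i z => z • e i‖ ^ 2 = c.sum fun _ z => ‖z‖ ^ 2 := by
  have h := he.inner_finsupp_eq_sum_left c c
  have h2 : Finsupp.linearCombination ℂ e c = c.sum fun i z => z • e i := rfl
  rw [h2] at h
  have h3 := inner_self_eq_norm_sq_to_K (𝕜 := ℂ) (c.sum fun i z => z • e i)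
  rw [h] at h3
  simp only [Complex.conj_mul', Finsupp.sum] at h3
  have h4 : ((∑ i ∈ c.support, ‖c i‖ ^ 2 : ℝ) : ℂ) = ((‖c.sum fun i z => z • e i‖ ^ 2 : ℝ) : ℂ) := by
    push_cast
    exact h3
  exact (Complex.ofReal_injective h4).symm

/-- The inverse of `U` is bounded by the open mapping theorem. -/
theorem IsRieszBasis.exists_isLowerRieszBound [CompleteSpace E] {v : ι → E}
    (hv : IsRieszBasis v) : ∃ a, IsLowerRieszBound v a := by
  obtain ⟨e, U, hU, hvU⟩ := hv
  let V := ContinuousLinearEquiv.ofBijective U (LinearMap.ker_eq_bot.mpr hU.1)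
    (LinearMap.range_eq_top.mpr hU.2)
  have hV : ∀ y, V y = U y := fun y => rfl
  set N := ‖(V.symm : E →L[ℂ] E)‖ with hN
  -- `N + 1` in place of `N` keeps the constant positive even if `E` is trivial.
  refine ⟨((N + 1) ^ 2)⁻¹, by positivity, fun c => ?_⟩
  have hsum : (c.sum fun i z => z • v i) = U (c.sum fun i z => z • e i) := by
    simp [Finsupp.sum, map_sum, hvU]
  have hle : ‖c.sum fun i z => z • e i‖ ≤ (N + 1) * ‖U (c.sum fun i z => z • e i)‖ := by
    have := (V.symm : E →L[ℂ] E).le_opNorm (U (c.sum fun i z => z • e i))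
    rw [← hV] at this ⊢
    simp only [ContinuousLinearEquiv.coe_coe, ContinuousLinearEquiv.symm_apply_apply] at this
    refine this.trans (mul_le_mul_of_nonneg_right ?_ (norm_nonneg _))
    rw [hN]; linarith
  rw [← norm_sq_sum_orthonormal e.orthonormal c, hsum, inv_mul_le_iff₀ (by positivity), ← mul_pow]
  exact pow_le_pow_left₀ (norm_nonneg _) hle 2

theorem finsupp_sum_indicator {N : Type*} [AddCommMonoid N] (s : Finset ι) (x : ι → ℂ)
    (f : ι → ℂ → N) (hf : ∀ i, f i 0 = 0) :
    (Finsupp.indicator s fun i _ => x i).sum f = ∑ i ∈ s, f i (x i) := by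
  rw [Finsupp.sum_of_support_subset _ (Finsupp.support_indicator_subset _ _) _ fun i _ => hf i]
  exact Finset.sum_congr rfl fun i hi => by rw [Finsupp.indicator_of_mem hi]

theorem norm_sq_finset_sum_le {v : ι → E} {b : ℝ} (hb : IsUpperRieszBound v b) (x : ι → ℂ)
    (s : Finset ι) : ‖∑ i ∈ s, x i • v i‖ ^ 2 ≤ b * ∑ i ∈ s, ‖x i‖ ^ 2 := by
  classical
  have := hb.2 (Finsupp.indicator s fun i _ => x i)
  rwa [finsupp_sum_indicator s x _ (by simp), finsupp_sum_indicator s x _ (by simp)] at this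

theorem le_norm_sq_finset_sum {v : ι → E} {a : ℝ} (ha : IsLowerRieszBound v a) (x : ι → ℂ)
    (s : Finset ι) : a * ∑ i ∈ s, ‖x i‖ ^ 2 ≤ ‖∑ i ∈ s, x i • v i‖ ^ 2 := by
  classical
  have := ha.2 (Finsupp.indicator s fun i _ => x i)
  rwa [finsupp_sum_indicator s x _ (by simp), finsupp_sum_indicator s x _ (by simp)] at this

theorem hasSum_norm_sq (x : ell 2 ι) : HasSum (fun i => ‖x i‖ ^ 2) (‖x‖ ^ 2) := by
  have := lp.hasSum_norm (p := 2) (by norm_num) x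
  simpa using this

variable [CompleteSpace E]

/-- Cauchy's criterion: the upper bound controls finite blocks of the series by blocks of `∑
|x_i|²`. -/
theorem summable_smul_of_isUpperRieszBound {v : ι → E} {b : ℝ} (hb : IsUpperRieszBound v b)
    (x : ell 2 ι) : Summable fun i => x i • v i := by
  rw [summable_iff_vanishing_norm]
  intro ε hε
  obtain ⟨s, hs⟩ := summable_iff_vanishing_norm.mp (hasSum_norm_sq x).summable (ε ^ 2 / b)
    (div_pos (pow_pos hε 2) hb.1)
  refine ⟨s, fun t ht => ?_⟩
  have h1 := norm_sq_finset_sum_le hb x t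
  have h2 := (le_abs_self _).trans_lt (hs t ht)
  rw [lt_div_iff₀ hb.1, mul_comm] at h2
  exact lt_of_pow_lt_pow_left₀ 2 hε.le (h1.trans_lt h2)

theorem norm_sq_tsum_smul_le {v : ι → E} {b : ℝ} (hb : IsUpperRieszBound v b) (x : ell 2 ι) :
    ‖∑' i, x i • v i‖ ^ 2 ≤ b * ‖x‖ ^ 2 :=
  le_of_tendsto_of_tendsto' ((summable_smul_of_isUpperRieszBound hb x).hasSum.norm.pow 2)
    (Tendsto.const_mul b (hasSum_norm_sq x)) (norm_sq_finset_sum_le hb x)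

theorem le_norm_sq_tsum_smul {v : ι → E} {a b : ℝ} (ha : IsLowerRieszBound v a)
    (hb : IsUpperRieszBound v b) (x : ell 2 ι) : a * ‖x‖ ^ 2 ≤ ‖∑' i, x i • v i‖ ^ 2 :=
  le_of_tendsto_of_tendsto' (Tendsto.const_mul a (hasSum_norm_sq x))
    ((summable_smul_of_isUpperRieszBound hb x).hasSum.norm.pow 2) (le_norm_sq_finset_sum ha x)

/-- The synthesis operator `x ↦ ∑ x_i v_i` on `ℓ²` of a family with an upper Riesz bound. -/
def synthesisOperator (v : ι → E) {b : ℝ} (hb : IsUpperRieszBound v b) : ell 2 ι →L[ℂ] E :=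
  LinearMap.mkContinuous
    { toFun := fun x => ∑' i, x i • v i
      map_add' := fun x y => by
        rw [← (summable_smul_of_isUpperRieszBound hb x).tsum_add
          (summable_smul_of_isUpperRieszBound hb y)]
        simp [add_smul]
      map_smul' := fun r x => by
        rw [RingHom.id_apply, ← (summable_smul_of_isUpperRieszBound hb x).tsum_const_smul r]
        simp [mul_smul] }
    (Real.sqrt b) fun x => by
      refine le_of_sq_le_sq ?_ (by positivity)
      rw [mul_pow, Real.sq_sqrt hb.1.le]
      exact norm_sq_tsum_smul_le hb x

theorem synthesisOperator_apply (v : ι → E) {b : ℝ} (hb : IsUpperRieszBound v b) (x : ell 2 ι) :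
    synthesisOperator v hb x = ∑' i, x i • v i := rfl

theorem synthesisOperator_single [DecidableEq ι] (v : ι → E) {b : ℝ} (hb : IsUpperRieszBound v b)
    (i : ι) : synthesisOperator v hb (lp.single 2 i 1) = v i := by
  rw [synthesisOperator_apply, tsum_eq_single i fun j hj => by simp [hj]]
  simp

/-- A complete Riesz sequence, indexed by a set of the size of the Hilbert dimension, is a Riesz
basis. -/
theorem isRieszBasis_of_bounds {v : ι → E} {a b : ℝ} (e : HilbertBasis ι ℂ E)
    (ha : IsLowerRieszBound v a) (hb : IsUpperRieszBound v b)
    (hd : Dense (Submodule.span ℂ (Set.range v) : Set E)) : IsRieszBasis v := by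
  classical
  -- The lower bound gives injectivity and closed range; density of the span then gives
  -- surjectivity.
  have hanti : AntilipschitzWith (Real.toNNReal (Real.sqrt a)⁻¹) (synthesisOperator v hb) := by
    refine AddMonoidHomClass.antilipschitz_of_bound _ fun x => ?_
    have hsa : 0 < Real.sqrt a := Real.sqrt_pos.mpr ha.1
    rw [Real.coe_toNNReal _ (by positivity), le_inv_mul_iff₀ hsa]
    refine le_of_sq_le_sq ?_ (by positivity)
    rw [mul_pow, Real.sq_sqrt ha.1.le]
    exact le_norm_sq_tsum_smul ha hb x
  have hclosed : IsClosed (Set.range (synthesisOperator v hb)) :=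
    hanti.isClosed_range (synthesisOperator v hb).uniformContinuous
  have hsub : (Submodule.span ℂ (Set.range v) : Set E) ⊆ Set.range (synthesisOperator v hb) := by
    have : Submodule.span ℂ (Set.range v) ≤ (synthesisOperator v hb : ell 2 ι →ₗ[ℂ] E).range := by
      rw [Submodule.span_le]
      rintro _ ⟨i, rfl⟩
      exact ⟨lp.single 2 i 1, synthesisOperator_single v hb i⟩
    exact this
  have hsurj : Function.Surjective (synthesisOperator v hb) := fun y =>
    hclosed.closure_subset_iff.mpr hsub (hd y)
  -- `e.repr` identifies `E` with `ℓ²(ι)`, so the composite is an operator on `E` itself sending `e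
  -- i` to `v i`.
  refine ⟨e, (synthesisOperator v hb).comp (e.repr : E ≃L[ℂ] ell 2 ι).toContinuousLinearMap,
    ⟨hanti.injective.comp e.repr.injective, hsurj.comp e.repr.surjective⟩, fun i => ?_⟩
  change v i = synthesisOperator v hb (e.repr (e i))
  rw [e.repr_self, synthesisOperator_single]

/-- The standard basis of `ℓ²(J)`, indexed through a bijection. -/
theorem exists_hilbertBasis_reindex {J : Type*} (σ : ι ≃ J) :
    Nonempty (HilbertBasis ι ℂ (ell 2 J)) := by
  classical
  let b : HilbertBasis J ℂ (ell 2 J) := HilbertBasis.ofRepr (LinearIsometryEquiv.refl ℂ _)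
  refine ⟨HilbertBasis.mk (v := fun i => b (σ i)) (b.orthonormal.comp σ σ.injective) ?_⟩
  have : Set.range (fun i => b (σ i)) = Set.range b := σ.surjective.range_comp b
  rw [this, b.dense_span]

theorem span_single_dense {J : Type*} [DecidableEq J] :
    Dense (Submodule.span ℂ (Set.range fun n : J => (lp.single 2 n 1 : ell 2 J)) : Set (ell 2 J)) := by
  let b : HilbertBasis J ℂ (ell 2 J) := HilbertBasis.ofRepr (LinearIsometryEquiv.refl ℂ _)
  have hb : (fun n : J => (lp.single 2 n 1 : ell 2 J)) = b := by
    ext1 n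
    rw [← b.repr_symm_single]
    rfl
  rw [hb]
  exact Submodule.dense_iff_topologicalClosure_eq_top.mpr b.dense_span

end RieszSequences

/-! ### From integral inequalities to pointwise ones -/

section Localization

variable {G : Type*} [AddCommGroup G] {M : AddSubgroup G}

/-- A continuous function whose integrals against all squared trigonometric polynomials are
nonnegative is nonnegative. -/
theorem nonneg_of_integral_norm_sq_fourier_mul (ψ : AddChar M Circle → ℝ) (hψ : Continuous ψ)
    (h : ∀ d : M →₀ ℂ, 0 ≤ ∫ γ, ‖fourier M d γ‖ ^ 2 * ψ γ ∂(dualHaar M)) (γ : AddChar M Circle) :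
    0 ≤ ψ γ := by
  -- With `φ` the square root of the negative part `ψ⁻`, approximating `φ` by trigonometric
  -- polynomials yields `0 ≤ ∫ |φ|² ψ = -∫ (ψ⁻)²`.
  set φ : AddChar M Circle → ℂ := fun γ => ((Real.sqrt (max (-ψ γ) 0) : ℝ) : ℂ) with hφdef
  have hφ : Continuous φ := Complex.continuous_ofReal.comp
    (Real.continuous_sqrt.comp (hψ.neg.max continuous_const))
  have hφsq : ∀ γ, ‖φ γ‖ ^ 2 = max (-ψ γ) 0 := fun γ => by
    rw [hφdef, Complex.norm_real, Real.norm_of_nonneg (Real.sqrt_nonneg _),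
      Real.sq_sqrt (le_max_right _ _)]
  obtain ⟨C, hC⟩ : ∃ C, ∀ γ, ‖φ γ‖ ≤ C := by
    obtain ⟨C, hC⟩ := isCompact_univ.exists_bound_of_continuousOn hφ.continuousOn
    exact ⟨C, fun γ => hC γ (Set.mem_univ γ)⟩
  obtain ⟨D, hD⟩ : ∃ D, ∀ γ, ‖ψ γ‖ ≤ D := by
    obtain ⟨D, hD⟩ := isCompact_univ.exists_bound_of_continuousOn hψ.continuousOn
    exact ⟨D, fun γ => hD γ (Set.mem_univ γ)⟩
  choose d hd using fun n : ℕ => exists_fourier_approx φ hφ (ε := 1 / ((n : ℝ) + 1)) (by positivity)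
  have hlim : Tendsto (fun n => ∫ γ, ‖fourier M (d n) γ‖ ^ 2 * ψ γ ∂(dualHaar M)) atTop
      (𝓝 (∫ γ, ‖φ γ‖ ^ 2 * ψ γ ∂(dualHaar M))) := by
    refine tendsto_integral_of_dominated_convergence (fun _ => (1 + C) ^ 2 * D) (fun n => ?_)
      (integrable_const _) (fun n => ae_of_all _ fun γ => ?_) (ae_of_all _ fun γ => ?_)
    · exact (((continuous_fourier (summable_norm_finsupp (d n))).norm.pow 2).mul
        hψ).aestronglyMeasurable
    · have h1 : ‖fourier M (d n) γ‖ ≤ 1 + C := by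
        have h2 : 1 / ((n : ℝ) + 1) ≤ 1 := by
          rw [div_le_one (by positivity)]
          linarith [Nat.cast_nonneg (α := ℝ) n]
        have h3 := norm_le_norm_sub_add (fourier M (d n) γ) (φ γ)
        linarith [hd n γ, hC γ]
      rw [norm_mul, norm_pow, norm_norm]
      exact mul_le_mul (pow_le_pow_left₀ (norm_nonneg _) h1 2) (hD γ) (norm_nonneg _) (by positivity)
    · refine Tendsto.mul_const _ (Tendsto.pow (Tendsto.norm ?_) 2)
      rw [tendsto_iff_norm_sub_tendsto_zero]
      exact squeeze_zero (fun n => norm_nonneg _) (fun n => (hd n γ).le)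
        tendsto_one_div_add_atTop_nhds_zero_nat
  have hge := ge_of_tendsto' hlim fun n => h (d n)
  have heq : ∀ γ, ‖φ γ‖ ^ 2 * ψ γ = -(max (-ψ γ) 0) ^ 2 := fun γ => by
    rw [hφsq]
    rcases le_total (-ψ γ) 0 with h0 | h0
    · simp [max_eq_right h0]
    · rw [max_eq_left h0]; ring
  simp_rw [heq] at hge
  rw [integral_neg] at hge
  have hcont : Continuous fun γ => (max (-ψ γ) 0) ^ 2 := (hψ.neg.max continuous_const).pow 2
  have hzero : ∫ γ, (max (-ψ γ) 0) ^ 2 ∂(dualHaar M) = 0 :=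
    le_antisymm (by linarith) (integral_nonneg fun γ => sq_nonneg _)
  rw [integral_eq_zero_iff_of_nonneg (fun γ => sq_nonneg _) (integrable_of_continuous hcont)]
    at hzero
  -- Haar measure charges nonempty open sets, so a continuous function vanishing almost everywhere
  -- vanishes everywhere.
  have := (pow_eq_zero_iff two_ne_zero).mp
    (congrFun ((hcont.ae_eq_iff_eq _ continuous_const).mp hzero) γ)
  have h2 := le_max_left (-ψ γ) 0
  linarith

/-- The product coefficients `d m * v k` supply test families with a fixed direction `v` and a free
scalar profile. -/
theorem exists_coeffFourier_eq_smul {κ : Type*} [Fintype κ] (v : κ → ℂ) (d : M →₀ ℂ) :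
    ∃ c : κ × M →₀ ℂ, ∀ γ, coeffFourier c γ = fourier M d γ • v := by
  refine ⟨Finsupp.ofSupportFinite (fun p => d p.2 * v p.1) ?_, fun γ => ?_⟩
  · refine (Set.finite_univ.prod d.hasFiniteSupport).subset ?_
    rintro ⟨k, m⟩ hp
    exact Set.mk_mem_prod (Set.mem_univ k) (left_ne_zero_of_mul hp)
  · ext k
    change fourier M (fun m => d m * v k) γ = fourier M d γ * v k
    simp only [fourier, ← tsum_mul_right]
    exact tsum_congr fun m => by ring

end Localization

/-! ### Optimal bounds, completeness and the Riesz basis criterion -/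

section Bounds

variable {G : Type*} [AddCommGroup G] {M : AddSubgroup G} {κ : Type*}

theorem fourier_single_coset [DecidableEq G] [DecidableEq κ] (l : κ → G)
    (hl : Function.Bijective fun i => (QuotientAddGroup.mk (l i) : G ⧸ M))
    (i j : κ) (m : M) (γ : AddChar M Circle) :
    fourier M (fun m' => (lp.single 2 ((m : G) + l j) 1 : ell 2 G) ((m' : G) + l i)) γ =
      (conj ((γ m : Circle) : ℂ) • (Pi.single j 1 : κ → ℂ)) i := by
  classical
  have key : ∀ m' : M, (lp.single 2 ((m : G) + l j) 1 : ell 2 G) ((m' : G) + l i) =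
      if i = j then Finsupp.single m (1 : ℂ) m' else 0 := by
    intro m'
    rw [lp.coeFn_single, Pi.single_apply, Finsupp.single_apply]
    have := (cosetEquiv l hl).injective.eq_iff (a := (i, m')) (b := (j, m))
    simp only [cosetEquiv_apply, Prod.mk.injEq] at this
    rw [if_congr this rfl rfl, ite_and]
    simp only [eq_comm]
  simp only [key]
  by_cases hij : i = j
  · subst hij
    simp only [if_true]
    rw [fourier_single]
    simp
  · simp [fourier, hij]

variable [Fintype κ]

theorem continuous_sum_norm_sq_polyphase (h : κ → ell 1 G) (l : κ → G)
    {w : AddChar M Circle → κ → ℂ} (hw : Continuous w) :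
    Continuous fun γ => ∑ j, ‖((polyphase M h l γ)ᴴ *ᵥ w γ) j‖ ^ 2 :=
  continuous_finsetSum _ fun j _ => (((continuous_apply j).comp
    ((continuous_polyphase h l).matrix_conjTranspose.matrix_mulVec hw)).norm).pow 2

theorem continuous_sum_norm_sq {w : AddChar M Circle → κ → ℂ} (hw : Continuous w) :
    Continuous fun γ => ∑ k, ‖w γ k‖ ^ 2 :=
  continuous_finsetSum _ fun k _ => (((continuous_apply k).comp hw).norm).pow 2

theorem sum_norm_sq_smul (z : ℂ) (v : κ → ℂ) :
    ∑ k, ‖(z • v) k‖ ^ 2 = ‖z‖ ^ 2 * ∑ k, ‖v k‖ ^ 2 := by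
  simp [mul_pow, Finset.mul_sum]

variable [Countable M]

theorem isUpperRieszBound_translates_iff (h : κ → ell 1 G) (l : κ → G)
    (hl : Function.Bijective fun i => (QuotientAddGroup.mk (l i) : G ⧸ M))
    {b : ℝ} :
    IsUpperRieszBound (translates M h) b ↔ 0 < b ∧ ∀ c : κ × M →₀ ℂ,
      ∫ γ, ∑ j, ‖((polyphase M h l γ)ᴴ *ᵥ coeffFourier c γ) j‖ ^ 2 ∂(dualHaar M) ≤
        b * ∫ γ, ∑ k, ‖coeffFourier c γ k‖ ^ 2 ∂(dualHaar M) := by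
  simp only [← norm_sq_synthesis h l hl, integral_coeffFourier]
  rfl

theorem isLowerRieszBound_translates_iff (h : κ → ell 1 G) (l : κ → G)
    (hl : Function.Bijective fun i => (QuotientAddGroup.mk (l i) : G ⧸ M))
    {a : ℝ} :
    IsLowerRieszBound (translates M h) a ↔ 0 < a ∧ ∀ c : κ × M →₀ ℂ,
      a * ∫ γ, ∑ k, ‖coeffFourier c γ k‖ ^ 2 ∂(dualHaar M) ≤
        ∫ γ, ∑ j, ‖((polyphase M h l γ)ᴴ *ᵥ coeffFourier c γ) j‖ ^ 2 ∂(dualHaar M) := by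
  simp only [← norm_sq_synthesis h l hl, integral_coeffFourier]
  rfl

variable [DecidableEq κ] [Nonempty κ]

theorem isLowerRieszBound_of_le_lambdaMin (h : κ → ell 1 G) (l : κ → G)
    (hl : Function.Bijective fun i => (QuotientAddGroup.mk (l i) : G ⧸ M))
    {a : ℝ} (ha : 0 < a)
    (hle : ∀ γ, a ≤ lambdaMin (polyphase M h l γ)) : IsLowerRieszBound (translates M h) a := by
  refine (isLowerRieszBound_translates_iff h l hl).mpr ⟨ha, fun c => ?_⟩
  have hc := continuous_coeffFourier c
  rw [← integral_const_mul]
  refine integral_mono (integrable_of_continuous (continuous_const.mul (continuous_sum_norm_sq hc)))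
    (integrable_of_continuous (continuous_sum_norm_sq_polyphase h l hc)) fun γ => ?_
  exact (le_lambdaMin_iff _ _).mp ((hle γ).trans_eq (lambdaMin_conjTranspose _).symm) _

theorem isUpperRieszBound_of_lambdaMax_le (h : κ → ell 1 G) (l : κ → G)
    (hl : Function.Bijective fun i => (QuotientAddGroup.mk (l i) : G ⧸ M))
    {b : ℝ} (hb : 0 < b)
    (hle : ∀ γ, lambdaMax (polyphase M h l γ) ≤ b) : IsUpperRieszBound (translates M h) b := by
  refine (isUpperRieszBound_translates_iff h l hl).mpr ⟨hb, fun c => ?_⟩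
  have hc := continuous_coeffFourier c
  rw [← integral_const_mul]
  refine integral_mono (integrable_of_continuous (continuous_sum_norm_sq_polyphase h l hc))
    (integrable_of_continuous (continuous_const.mul (continuous_sum_norm_sq hc))) fun γ => ?_
  exact (lambdaMax_le_iff _ _).mp ((lambdaMax_conjTranspose _).trans_le (hle γ)) _

/-- For fixed `v`, the families `d m * v k` put the weight `|d̂|²` on the difference of the two
quadratic forms at `v`; localization makes that difference nonnegative at each `γ`. -/
theorem IsLowerRieszBound.le_lambdaMin (h : κ → ell 1 G) (l : κ → G)
    (hl : Function.Bijective fun i => (QuotientAddGroup.mk (l i) : G ⧸ M))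
    {a : ℝ} (ha : IsLowerRieszBound (translates M h) a)
    (γ : AddChar M Circle) : a ≤ lambdaMin (polyphase M h l γ) := by
  rw [← lambdaMin_conjTranspose, le_lambdaMin_iff]
  intro v
  have hv : Continuous fun _ : AddChar M Circle => v := continuous_const
  rw [← sub_nonneg]
  refine nonneg_of_integral_norm_sq_fourier_mul (fun γ => ∑ j, ‖((polyphase M h l γ)ᴴ *ᵥ v) j‖ ^ 2 -
    a * ∑ k, ‖v k‖ ^ 2) ((continuous_sum_norm_sq_polyphase h l hv).sub continuous_const)
    (fun d => ?_) γ
  obtain ⟨c, hc⟩ := exists_coeffFourier_eq_smul v d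
  have key := ((isLowerRieszBound_translates_iff h l hl).mp ha).2 c
  have hd : Continuous fun γ => ‖fourier M d γ‖ ^ 2 :=
    (continuous_fourier (summable_norm_finsupp d)).norm.pow 2
  have h1 : Integrable (fun γ => ‖fourier M d γ‖ ^ 2 *
      ∑ j, ‖((polyphase M h l γ)ᴴ *ᵥ v) j‖ ^ 2) (dualHaar M) :=
    integrable_of_continuous (hd.mul (continuous_sum_norm_sq_polyphase h l hv))
  have h2 : Integrable (fun γ => a * (‖fourier M d γ‖ ^ 2 * ∑ k, ‖v k‖ ^ 2)) (dualHaar M) :=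
    integrable_of_continuous (continuous_const.mul (hd.mul continuous_const))
  simp only [hc, Matrix.mulVec_smul, sum_norm_sq_smul] at key
  rw [← integral_const_mul, ← sub_nonneg, ← integral_sub h1 h2] at key
  refine key.trans_eq (integral_congr_ae (ae_of_all _ fun γ => ?_))
  simp only
  ring

theorem IsUpperRieszBound.lambdaMax_le (h : κ → ell 1 G) (l : κ → G)
    (hl : Function.Bijective fun i => (QuotientAddGroup.mk (l i) : G ⧸ M))
    {b : ℝ} (hb : IsUpperRieszBound (translates M h) b)
    (γ : AddChar M Circle) : lambdaMax (polyphase M h l γ) ≤ b := by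
  rw [← lambdaMax_conjTranspose, lambdaMax_le_iff]
  intro v
  have hv : Continuous fun _ : AddChar M Circle => v := continuous_const
  rw [← sub_nonneg]
  refine nonneg_of_integral_norm_sq_fourier_mul (fun γ => b * ∑ k, ‖v k‖ ^ 2 -
    ∑ j, ‖((polyphase M h l γ)ᴴ *ᵥ v) j‖ ^ 2)
    (continuous_const.sub (continuous_sum_norm_sq_polyphase h l hv)) (fun d => ?_) γ
  obtain ⟨c, hc⟩ := exists_coeffFourier_eq_smul v d
  have key := ((isUpperRieszBound_translates_iff h l hl).mp hb).2 c
  have hd : Continuous fun γ => ‖fourier M d γ‖ ^ 2 :=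
    (continuous_fourier (summable_norm_finsupp d)).norm.pow 2
  have h1 : Integrable (fun γ => ‖fourier M d γ‖ ^ 2 *
      ∑ j, ‖((polyphase M h l γ)ᴴ *ᵥ v) j‖ ^ 2) (dualHaar M) :=
    integrable_of_continuous (hd.mul (continuous_sum_norm_sq_polyphase h l hv))
  have h2 : Integrable (fun γ => b * (‖fourier M d γ‖ ^ 2 * ∑ k, ‖v k‖ ^ 2)) (dualHaar M) :=
    integrable_of_continuous (continuous_const.mul (hd.mul continuous_const))
  simp only [hc, Matrix.mulVec_smul, sum_norm_sq_smul] at key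
  rw [← integral_const_mul, ← sub_nonneg, ← integral_sub h2 h1] at key
  refine key.trans_eq (integral_congr_ae (ae_of_all _ fun γ => ?_))
  simp only
  ring

/-- Nonsingularity of the polyphase matrix implies completeness of the translates. -/
theorem dense_span_translates (h : κ → ell 1 G) (l : κ → G)
    (hl : Function.Bijective fun i => (QuotientAddGroup.mk (l i) : G ⧸ M))
    (hdet : ∀ γ, (polyphase M h l γ).det ≠ 0) :
    Dense (Submodule.span ℂ (Set.range (translates M h)) : Set (ell 2 G)) := by
  classical
  obtain ⟨B, -, hB⟩ := exists_isGreatest_lambdaMax (continuous_polyphase (M := M) h l)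
  have hB' : ∀ γ (v : κ → ℂ), ∑ j, ‖((polyphase M h l γ)ᴴ *ᵥ v) j‖ ^ 2 ≤
      |B| * ∑ i, ‖v i‖ ^ 2 := fun γ v =>
    (lambdaMax_le_iff _ _).mp ((lambdaMax_conjTranspose _).trans_le
      ((hB ⟨γ, rfl⟩).trans (le_abs_self B))) v
  suffices hs : Set.range (fun n : G => (lp.single 2 n 1 : ell 2 G)) ⊆
      (Submodule.span ℂ (Set.range (translates M h))).topologicalClosure by
    have h1 := Submodule.span_le.mpr hs
    intro x
    have h2 := closure_mono (SetLike.coe_subset_coe.mpr h1) (span_single_dense x)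
    rwa [(Submodule.isClosed_topologicalClosure _).closure_eq] at h2
  rintro _ ⟨n, rfl⟩
  obtain ⟨⟨j, m⟩, rfl⟩ := (cosetEquiv l hl).surjective n
  rw [cosetEquiv_apply]
  refine Metric.mem_closure_iff.mpr fun ε hε => ?_
  set u : AddChar M Circle → κ → ℂ := fun γ => conj ((γ m : Circle) : ℂ) • Pi.single j 1 with hu
  have hQ : Continuous fun γ => (polyphase M h l γ)ᴴ :=
    (continuous_polyphase h l).matrix_conjTranspose
  have hQdet : ∀ γ, ((polyphase M h l γ)ᴴ).det ≠ 0 := fun γ => by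
    rw [Matrix.det_conjTranspose]
    exact star_ne_zero.mpr (hdet γ)
  -- Cramer's rule exhibits the solution of `Hᴴ w = u` as continuous in `γ`.
  set w : AddChar M Circle → κ → ℂ := fun γ =>
    ((polyphase M h l γ)ᴴ).det⁻¹ • (((polyphase M h l γ)ᴴ).adjugate *ᵥ u γ) with hw
  have hucont : Continuous u :=
    (Complex.continuous_conj.comp (continuous_addChar_coe m)).smul continuous_const
  have hwcont : Continuous w :=
    (hQ.matrix_det.inv₀ hQdet).smul (hQ.matrix_adjugate.matrix_mulVec hucont)
  have hQw : ∀ γ, (polyphase M h l γ)ᴴ *ᵥ w γ = u γ := fun γ => by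
    rw [hw, Matrix.mulVec_smul, Matrix.mulVec_mulVec, Matrix.mul_adjugate, Matrix.smul_mulVec,
      Matrix.one_mulVec, smul_smul, inv_mul_cancel₀ (hQdet γ), one_smul]
  -- Uniform error `ε / √R` in each coordinate gives squared distance at most `|B| * card κ * ε² /
  -- R`; the summand `1` makes this strictly less than `ε²`.
  set R := |B| * Fintype.card κ + 1 with hR
  have hRpos : 0 < R := by positivity
  have hδ : 0 < ε / Real.sqrt R := div_pos hε (Real.sqrt_pos.mpr hRpos)
  obtain ⟨c, hc⟩ := exists_coeffFourier_approx w hwcont hδ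
  refine ⟨synthesis h c, ?_, ?_⟩
  · exact Submodule.sum_mem _ fun p _ =>
      Submodule.smul_mem _ _ (Submodule.subset_span ⟨p, rfl⟩)
  · rw [dist_comm, dist_eq_norm]
    set x : ell 2 G := lp.single 2 ((m : G) + l j) 1 with hx
    have hxs : Summable fun n => ‖x n‖ := by
      refine summable_of_ne_finset_zero (s := {(m : G) + l j}) fun b hb => ?_
      rw [Finset.mem_singleton] at hb
      rw [hx, lp.coeFn_single, Pi.single_eq_of_ne hb, norm_zero]
    have hsum : Summable fun n => ‖(synthesis h c - x) n‖ :=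
      Summable.of_nonneg_of_le (fun _ => norm_nonneg _) (fun n => norm_sub_le _ _)
        ((summable_synthesis h c).add hxs)
    have hval : ∀ γ i, fourier M (fun m' => (synthesis h c - x) ((m' : G) + l i)) γ =
        ((polyphase M h l γ)ᴴ *ᵥ (coeffFourier c γ - w γ)) i := fun γ i => by
      rw [Matrix.mulVec_sub, hQw, Pi.sub_apply, ← fourier_synthesis,
        show u γ i = _ from (fourier_single_coset l hl i j m γ).symm]
      exact fourier_sub (summable_comp_coset (summable_synthesis h c) _)
        (summable_comp_coset hxs _) γ
    have hbound : ‖synthesis h c - x‖ ^ 2 ≤ |B| * (Fintype.card κ * (ε / Real.sqrt R) ^ 2) := by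
      rw [norm_sq_eq_integral_cosets l hl _ hsum]
      simp only [hval]
      have hdiff : Continuous fun γ => coeffFourier c γ - w γ :=
        (continuous_coeffFourier c).sub hwcont
      refine (integral_mono (integrable_of_continuous (continuous_sum_norm_sq_polyphase h l hdiff))
        (integrable_const (|B| * (Fintype.card κ * (ε / Real.sqrt R) ^ 2))) fun γ => ?_).trans_eq
        (by simp)
      refine (hB' γ _).trans (mul_le_mul_of_nonneg_left ?_ (abs_nonneg B))
      refine (Finset.sum_le_card_nsmul _ _ ((ε / Real.sqrt R) ^ 2) fun k _ => ?_).trans_eq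
        (by simp)
      exact pow_le_pow_left₀ (norm_nonneg _) (hc γ k).le 2
    refine lt_of_pow_lt_pow_left₀ 2 hε.le (hbound.trans_lt ?_)
    rw [div_pow, Real.sq_sqrt hRpos.le, ← mul_assoc, ← mul_div_assoc, div_lt_iff₀ hRpos, mul_comm]
    exact mul_lt_mul_of_pos_left (by rw [hR]; linarith) (by positivity)

theorem isRieszBasis_translates_iff (h : κ → ell 1 G) (l : κ → G)
    (hl : Function.Bijective fun i => (QuotientAddGroup.mk (l i) : G ⧸ M)) :
    IsRieszBasis (translates M h) ↔ ∀ γ, (polyphase M h l γ).det ≠ 0 := by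
  constructor
  · intro hR γ
    obtain ⟨a, ha⟩ := hR.exists_isLowerRieszBound
    exact (lambdaMin_pos_iff _).mp (ha.1.trans_le (ha.le_lambdaMin h l hl γ))
  · intro hdet
    obtain ⟨A, ⟨γ₀, hA⟩, hAle⟩ := exists_isLeast_lambdaMin (continuous_polyphase (M := M) h l)
    obtain ⟨B, -, hB⟩ := exists_isGreatest_lambdaMax (continuous_polyphase (M := M) h l)
    have hApos : 0 < A := hA ▸ (lambdaMin_pos_iff _).mpr (hdet γ₀)
    obtain ⟨e⟩ := exists_hilbertBasis_reindex (cosetEquiv l hl)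
    exact isRieszBasis_of_bounds e
      (isLowerRieszBound_of_le_lambdaMin h l hl hApos fun γ => hAle ⟨γ, rfl⟩)
      -- Any upper bound suffices here; `max B 1` has the required positivity at once.
      (isUpperRieszBound_of_lambdaMax_le h l hl (b := max B 1) (by positivity)
        fun γ => (hB ⟨γ, rfl⟩).trans (le_max_left _ _))
      (dense_span_translates h l hl hdet)

theorem exists_areOptimalRieszBounds_translates (h : κ → ell 1 G) (l : κ → G)
    (hl : Function.Bijective fun i => (QuotientAddGroup.mk (l i) : G ⧸ M))
    (hR : IsRieszBasis (translates M h)) :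
    ∃ A B : ℝ, IsLeast (Set.range fun γ => lambdaMin (polyphase M h l γ)) A ∧
      IsGreatest (Set.range fun γ => lambdaMax (polyphase M h l γ)) B ∧
      AreOptimalRieszBounds (translates M h) A B := by
  obtain ⟨A, hA⟩ := exists_isLeast_lambdaMin (continuous_polyphase (M := M) h l)
  obtain ⟨B, hB⟩ := exists_isGreatest_lambdaMax (continuous_polyphase (M := M) h l)
  have hdet := (isRieszBasis_translates_iff h l hl).mp hR
  obtain ⟨⟨γ₀, hγ₀⟩, hAle⟩ := hA
  obtain ⟨⟨γ₁, hγ₁⟩, hBge⟩ := hB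
  have hApos : 0 < A := hγ₀ ▸ (lambdaMin_pos_iff _).mpr (hdet γ₀)
  have hBpos : 0 < B := by
    have h1 : 0 < lambdaMin (polyphase M h l γ₁) := (lambdaMin_pos_iff _).mpr (hdet γ₁)
    exact h1.trans_le ((lambdaMin_le_lambdaMax _).trans_eq hγ₁)
  refine ⟨A, B, ⟨⟨γ₀, hγ₀⟩, hAle⟩, ⟨⟨γ₁, hγ₁⟩, hBge⟩, ⟨?_, fun a ha => ?_⟩, ⟨?_, fun b hb => ?_⟩⟩
  · exact isLowerRieszBound_of_le_lambdaMin h l hl hApos fun γ => hAle ⟨γ, rfl⟩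
  · exact (IsLowerRieszBound.le_lambdaMin h l hl ha γ₀).trans_eq hγ₀
  · exact isUpperRieszBound_of_lambdaMax_le h l hl hBpos fun γ => hBge ⟨γ, rfl⟩
  · exact hγ₁.symm.trans_le (IsUpperRieszBound.lambdaMax_le h l hl hb γ₁)

end Bounds

end FilterBank

end

theorem theorem4 {G : Type*} [AddCommGroup G] [Countable G]
    (M : AddSubgroup G) [M.FiniteIndex] (L : ℕ) (hL : M.index = L)
    (l : Fin L → G) (hl : Function.Bijective fun i => (QuotientAddGroup.mk (l i) : G ⧸ M))
    (K : ℕ) (hK : K = L) (h : Fin K → FilterBank.ell 1 G) :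
    (FilterBank.IsRieszBasis (FilterBank.translates M h) ↔
      ∀ γ : AddChar M Circle,
        ((FilterBank.polyphase M h l γ).submatrix (Fin.cast hK.symm) id).det ≠ 0) ∧
    (FilterBank.IsRieszBasis (FilterBank.translates M h) →
      ∃ A B : ℝ,
        IsLeast (Set.range fun γ : AddChar M Circle =>
          FilterBank.lambdaMin (FilterBank.polyphase M h l γ)) A ∧
        IsGreatest (Set.range fun γ : AddChar M Circle =>
          FilterBank.lambdaMax (FilterBank.polyphase M h l γ)) B ∧
        FilterBank.AreOptimalRieszBounds (FilterBank.translates M h) A B) := by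
  subst hK
  -- A nonzero index excludes the empty matrix, for which the infimum and supremum of eigenvalues
  -- would be the default value `0`.
  have : Nonempty (Fin K) := Fin.pos_iff_nonempty.mp
    (Nat.pos_of_ne_zero (hL ▸ AddSubgroup.FiniteIndex.index_ne_zero))
  exact ⟨FilterBank.isRieszBasis_translates_iff h l hl,
    FilterBank.exists_areOptimalRieszBounds_translates h l hl⟩
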